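/- All norms are the normalized norms of $L_q(0,2\pi)$: $\|f\|_1=\frac1{2\pi}\int_0^{2\pi}|f(x)|\,dx$ and $\|f\|_\infty=\operatorname{ess\,sup}_{x\in(0,2\pi)}|f(x)|$. A real trigonometric polynomial of degree at most $n$ is a function $\sum_{k=0}^{n}(a_k\cos kx+b_k\sin kx)$ with $a_k,b_k\in\mathbb R$. There exist absolute constants $c_-,c_+,C>0$ such that for every real $\varepsilon$ with $0\le\varepsilon<1$ there is a sequence $\{p_j\}_{j=1}^\infty$ of real trigonometric polynomials with $$\deg p_j\le 2^{\,j-j^{\varepsilon}},\qquad c_-\le\|p_j\|_1\le\|p_j\|_\infty\le c_+\qquad(j=1,2,\dots)$$ and $$\Big\|\sum_{j=1}^{N}p_j(x)\cos 2^{j}x\Big\|_\infty\le C\,N^{\max(\varepsilon,\frac12)}\qquad\text{for all }N=1,2,\dots.$$ -/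

import Mathlib

open MeasureTheory

/-- `f` is a real trigonometric polynomial of degree at most `n`:
`f x = ∑_{k=0}^{n} (a_k cos (k x) + b_k sin (k x))` with real coefficients. -/
def IsRealTrigPolyOfDegreeLE (n : ℕ) (f : ℝ → ℝ) : Prop :=
  ∃ a b : ℕ → ℝ, ∀ x : ℝ,
    f x = ∑ k ∈ Finset.range (n + 1),
      (a k * Real.cos ((k : ℝ) * x) + b k * Real.sin ((k : ℝ) * x))

/-- `f` is a real trigonometric polynomial. -/
def IsRealTrigPoly (f : ℝ → ℝ) : Prop :=
  ∃ n : ℕ, IsRealTrigPolyOfDegreeLE n f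

/-- The degree of a real trigonometric polynomial: the least `n` such that `f` is a real
trigonometric polynomial of degree at most `n` (only meaningful if `IsRealTrigPoly f`). -/
noncomputable def trigDegree (f : ℝ → ℝ) : ℕ :=
  sInf {n : ℕ | IsRealTrigPolyOfDegreeLE n f}

/-- Lebesgue measure on `(0, 2π)`, normalized to total mass one. -/
noncomputable def normalizedMeasure : Measure ℝ :=
  (ENNReal.ofReal (2 * Real.pi))⁻¹ • volume.restrict (Set.Ioo 0 (2 * Real.pi))

/-- The normalized norm of `L_q(0, 2π)`, for `1 ≤ q ≤ ∞`: for finite `q` it is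
`((1 / 2π) ∫_0^{2π} |f|^q)^(1/q)`, for `q = ∞` the essential supremum of `|f|`. -/
noncomputable def trigNorm (q : ENNReal) (f : ℝ → ℝ) : ENNReal :=
  eLpNorm f q normalizedMeasure

/-!
The coefficients are produced by a delayed feedback that keeps the partial sums `S N` of the
lacunary series bounded by `100 * T N`, where `T` is monotone and `√N ≤ T N`. The coefficient `p j`
is a polynomial cutoff of a partial sum `S m` with `m` about `j - 3 * T j`: it takes values in
`[0, 1]`, is close to `1` where `S m` is small compared with `100 * T j`, and is tiny where `|S m|`
is close to `100 * T j`.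

Observing the sum with this delay costs only `O(T j)` in the sup norm, because the terms in between
are bounded by `1`, and it leaves room for the degree of the cutoff: composing `S m`, which has
degree about `2 ^ m`, with the cutoff, whose degree is `2 ^ O(T j)`, gives a degree of at most
`2 ^ (j - T j)`. Moreover each partial sum is orthogonal to the next term, so that the mean of
`S m ^ 2` is at most `m ≤ T j ^ 2`. Hence `S m` is small compared with `100 * T j` on most of the
circle, and the mean of `p j` is bounded below.
-/

namespace IsRealTrigPolyOfDegreeLE

variable {n m : ℕ} {f g : ℝ → ℝ}

theorem add (hf : IsRealTrigPolyOfDegreeLE n f) (hg : IsRealTrigPolyOfDegreeLE n g) :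
    IsRealTrigPolyOfDegreeLE n fun x => f x + g x := by
  obtain ⟨a, b, hf⟩ := hf
  obtain ⟨c, d, hg⟩ := hg
  refine ⟨a + c, b + d, fun x => ?_⟩
  simp only [hf, hg, ← Finset.sum_add_distrib]
  refine Finset.sum_congr rfl fun k _ => ?_
  simp only [Pi.add_apply]
  ring

theorem const_mul (c : ℝ) (hf : IsRealTrigPolyOfDegreeLE n f) :
    IsRealTrigPolyOfDegreeLE n fun x => c * f x := by
  obtain ⟨a, b, hf⟩ := hf
  refine ⟨fun k => c * a k, fun k => c * b k, fun x => ?_⟩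
  simp only [hf, Finset.mul_sum]
  exact Finset.sum_congr rfl fun k _ => by ring

theorem sum {ι : Type*} {s : Finset ι} {F : ι → ℝ → ℝ}
    (hF : ∀ i ∈ s, IsRealTrigPolyOfDegreeLE n (F i)) :
    IsRealTrigPolyOfDegreeLE n fun x => ∑ i ∈ s, F i x := by
  choose! a b hab using hF
  refine ⟨fun k => ∑ i ∈ s, a i k, fun k => ∑ i ∈ s, b i k, fun x => ?_⟩
  simp only [Finset.sum_mul, ← Finset.sum_add_distrib]
  rw [Finset.sum_comm]
  exact Finset.sum_congr rfl fun i hi => hab i hi x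

theorem cos_natCast_mul {k : ℕ} (hk : k ≤ n) :
    IsRealTrigPolyOfDegreeLE n fun x => Real.cos (k * x) :=
  ⟨Pi.single k 1, 0, fun x => by simp [Pi.single_apply, hk]⟩

theorem sin_natCast_mul {k : ℕ} (hk : k ≤ n) :
    IsRealTrigPolyOfDegreeLE n fun x => Real.sin (k * x) :=
  ⟨0, Pi.single k 1, fun x => by simp [Pi.single_apply, hk]⟩

theorem cos_intCast_mul {z : ℤ} (hz : z.natAbs ≤ n) :
    IsRealTrigPolyOfDegreeLE n fun x => Real.cos (z * x) := by
  rcases Int.natAbs_eq z with h | h <;> rw [h] <;> simpa using cos_natCast_mul hz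

theorem sin_intCast_mul {z : ℤ} (hz : z.natAbs ≤ n) :
    IsRealTrigPolyOfDegreeLE n fun x => Real.sin (z * x) := by
  rcases Int.natAbs_eq z with h | h <;> rw [h]
  · simpa using sin_natCast_mul hz
  · simpa using (sin_natCast_mul hz).const_mul (-1)

theorem const (n : ℕ) (c : ℝ) : IsRealTrigPolyOfDegreeLE n fun _ => c := by
  simpa using (cos_natCast_mul n.zero_le).const_mul c

theorem mono (hf : IsRealTrigPolyOfDegreeLE n f) (hnm : n ≤ m) :
    IsRealTrigPolyOfDegreeLE m f := by
  obtain ⟨a, b, hf⟩ := hf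
  rw [funext hf]
  refine sum fun k hk => ?_
  have hkm : k ≤ m := (Finset.mem_range_succ_iff.1 hk).trans hnm
  exact ((cos_natCast_mul hkm).const_mul _).add ((sin_natCast_mul hkm).const_mul _)

theorem harmonic_mul_harmonic {k l : ℕ} (hk : k ≤ n) (hl : l ≤ m) (a b c d : ℝ) :
    IsRealTrigPolyOfDegreeLE (n + m) fun x =>
      (a * Real.cos (k * x) + b * Real.sin (k * x)) *
        (c * Real.cos (l * x) + d * Real.sin (l * x)) := by
  have h_add : ((k : ℤ) + l).natAbs ≤ n + m := by omega
  have h_sub : ((k : ℤ) - l).natAbs ≤ n + m := by omega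
  convert ((((cos_intCast_mul h_add).const_mul ((a * c - b * d) / 2)).add
    ((cos_intCast_mul h_sub).const_mul ((a * c + b * d) / 2))).add
    ((sin_intCast_mul h_add).const_mul ((b * c + a * d) / 2))).add
    ((sin_intCast_mul h_sub).const_mul ((b * c - a * d) / 2)) using 2 with x
  push_cast
  rw [add_mul (k : ℝ), sub_mul (k : ℝ), Real.cos_add, Real.cos_sub, Real.sin_add, Real.sin_sub]
  ring

theorem mul (hf : IsRealTrigPolyOfDegreeLE n f) (hg : IsRealTrigPolyOfDegreeLE m g) :
    IsRealTrigPolyOfDegreeLE (n + m) fun x => f x * g x := by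
  obtain ⟨a, b, hf⟩ := hf
  obtain ⟨c, d, hg⟩ := hg
  simp only [hf, hg, Finset.sum_mul_sum]
  exact sum fun k hk => sum fun l hl => harmonic_mul_harmonic
    (Finset.mem_range_succ_iff.1 hk) (Finset.mem_range_succ_iff.1 hl) _ _ _ _

theorem pow (hf : IsRealTrigPolyOfDegreeLE n f) (k : ℕ) :
    IsRealTrigPolyOfDegreeLE (k * n) fun x => f x ^ k := by
  induction k with
  | zero => simpa using const 0 1
  | succ k ih => simpa only [pow_succ, Nat.succ_mul] using ih.mul hf

theorem const_sub (c : ℝ) (hf : IsRealTrigPolyOfDegreeLE n f) :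
    IsRealTrigPolyOfDegreeLE n fun x => c - f x := by
  simpa only [neg_one_mul, ← sub_eq_add_neg] using (const n c).add (hf.const_mul (-1))

theorem continuous (hf : IsRealTrigPolyOfDegreeLE n f) : Continuous f := by
  obtain ⟨a, b, hf⟩ := hf
  rw [funext hf]
  fun_prop

theorem trigDegree_le (hf : IsRealTrigPolyOfDegreeLE n f) : trigDegree f ≤ n :=
  Nat.sInf_le hf

end IsRealTrigPolyOfDegreeLE

section NormalizedMeasure

instance : IsProbabilityMeasure normalizedMeasure := by
  constructor
  rw [normalizedMeasure, Measure.smul_apply, Measure.restrict_apply_univ, Real.volume_Ioo, sub_zero,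
    smul_eq_mul]
  exact ENNReal.inv_mul_cancel (by simpa using Real.pi_pos) ENNReal.ofReal_ne_top

theorem integrable_normalizedMeasure_of_continuous {f : ℝ → ℝ} (hf : Continuous f) :
    Integrable f normalizedMeasure := by
  refine Integrable.smul_measure ?_ (by simpa using Real.pi_pos)
  exact (hf.integrableOn_Icc (a := 0) (b := 2 * Real.pi)).mono_set Set.Ioo_subset_Icc_self

theorem integral_normalizedMeasure (f : ℝ → ℝ) :
    ∫ x, f x ∂normalizedMeasure = (2 * Real.pi)⁻¹ * ∫ x in (0 : ℝ)..2 * Real.pi, f x := by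
  rw [normalizedMeasure, integral_smul_measure,
    intervalIntegral.integral_of_le Real.two_pi_pos.le, integral_Ioc_eq_integral_Ioo,
    ENNReal.toReal_inv, ENNReal.toReal_ofReal Real.two_pi_pos.le, smul_eq_mul]

theorem integral_cos_intCast_mul {z : ℤ} (hz : z ≠ 0) :
    ∫ x, Real.cos (z * x) ∂normalizedMeasure = 0 := by
  have h_sin : Real.sin (z * (2 * Real.pi)) = 0 := by
    simpa [mul_assoc] using Real.sin_int_mul_pi (z * 2)
  rw [integral_normalizedMeasure,
    intervalIntegral.integral_comp_mul_left _ (Int.cast_ne_zero.2 hz), integral_cos]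
  simp [h_sin]

theorem integral_sin_intCast_mul (z : ℤ) :
    ∫ x, Real.sin (z * x) ∂normalizedMeasure = 0 := by
  rcases eq_or_ne z 0 with rfl | hz
  · simp
  rw [integral_normalizedMeasure,
    intervalIntegral.integral_comp_mul_left _ (Int.cast_ne_zero.2 hz), integral_sin]
  simp [Real.cos_int_mul_two_pi z]

theorem integral_cos_mul_cos_eq_zero {k l : ℤ} (h_sub : k - l ≠ 0) (h_add : k + l ≠ 0) :
    ∫ x, Real.cos (k * x) * Real.cos (l * x) ∂normalizedMeasure = 0 := by
  have h_prod (x : ℝ) : Real.cos (k * x) * Real.cos (l * x) =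
      (Real.cos ((k - l : ℤ) * x) + Real.cos ((k + l : ℤ) * x)) / 2 := by
    push_cast
    rw [sub_mul, add_mul, ← Real.two_mul_cos_mul_cos]
    ring
  simp only [h_prod]
  rw [integral_div, integral_add (integrable_normalizedMeasure_of_continuous (by fun_prop))
    (integrable_normalizedMeasure_of_continuous (by fun_prop)), integral_cos_intCast_mul h_sub,
    integral_cos_intCast_mul h_add, add_zero, zero_div]

theorem integral_sin_mul_cos_eq_zero (k l : ℤ) :
    ∫ x, Real.sin (k * x) * Real.cos (l * x) ∂normalizedMeasure = 0 := by
  have h_prod (x : ℝ) : Real.sin (k * x) * Real.cos (l * x) =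
      (Real.sin ((k - l : ℤ) * x) + Real.sin ((k + l : ℤ) * x)) / 2 := by
    push_cast
    rw [sub_mul, add_mul, ← Real.two_mul_sin_mul_cos]
    ring
  simp only [h_prod]
  rw [integral_div, integral_add (integrable_normalizedMeasure_of_continuous (by fun_prop))
    (integrable_normalizedMeasure_of_continuous (by fun_prop)), integral_sin_intCast_mul,
    integral_sin_intCast_mul, add_zero, zero_div]

theorem IsRealTrigPolyOfDegreeLE.integral_mul_cos_eq_zero {n l : ℕ} {f : ℝ → ℝ}
    (hf : IsRealTrigPolyOfDegreeLE n f) (hnl : n < l) :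
    ∫ x, f x * Real.cos (l * x) ∂normalizedMeasure = 0 := by
  obtain ⟨a, b, hf⟩ := hf
  simp only [hf, Finset.sum_mul, add_mul, mul_assoc]
  rw [integral_finsetSum _ fun k _ => integrable_normalizedMeasure_of_continuous (by fun_prop)]
  refine Finset.sum_eq_zero fun k hk => ?_
  have hkl : k < l := (Finset.mem_range_succ_iff.1 hk).trans_lt hnl
  have h_cos := integral_cos_mul_cos_eq_zero (k := k) (l := l) (by omega) (by omega)
  have h_sin := integral_sin_mul_cos_eq_zero k l
  simp only [Int.cast_natCast] at h_cos h_sin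
  rw [integral_add (integrable_normalizedMeasure_of_continuous (by fun_prop))
    (integrable_normalizedMeasure_of_continuous (by fun_prop)), integral_const_mul,
    integral_const_mul, h_cos, h_sin, mul_zero, mul_zero, add_zero]

theorem trigNorm_top_le {f : ℝ → ℝ} {C : ℝ} (hf : ∀ x, |f x| ≤ C) :
    trigNorm ⊤ f ≤ ENNReal.ofReal C := by
  rw [trigNorm, eLpNorm_exponent_top]
  exact eLpNormEssSup_le_of_ae_bound (Filter.Eventually.of_forall hf)

theorem trigNorm_one_le_trigNorm_top {f : ℝ → ℝ} (hf : Continuous f) :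
    trigNorm 1 f ≤ trigNorm ⊤ f :=
  eLpNorm_le_eLpNorm_of_exponent_le le_top hf.aestronglyMeasurable

theorem ofReal_integral_le_trigNorm_one (f : ℝ → ℝ) :
    ENNReal.ofReal (∫ x, f x ∂normalizedMeasure) ≤ trigNorm 1 f := by
  rw [trigNorm, eLpNorm_one_eq_lintegral_enorm]
  calc ENNReal.ofReal (∫ x, f x ∂normalizedMeasure)
      ≤ ENNReal.ofReal ‖∫ x, f x ∂normalizedMeasure‖ := ENNReal.ofReal_le_ofReal (le_abs_self _)
    _ = ‖∫ x, f x ∂normalizedMeasure‖ₑ := ofReal_norm _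
    _ ≤ ∫⁻ x, ‖f x‖ₑ ∂normalizedMeasure := enorm_integral_le_lintegral_enorm f

end NormalizedMeasure

section LacunarySum

/-- The partial sum `∑ p j x * cos (2 ^ j * x)` over `1 ≤ j ≤ N` of the lacunary cosine series with
coefficients `p j`. -/
noncomputable def lacunarySum (p : ℕ → ℝ → ℝ) (N : ℕ) (x : ℝ) : ℝ :=
  ∑ j ∈ Finset.Icc 1 N, p j x * Real.cos ((2 : ℝ) ^ j * x)

variable {p : ℕ → ℝ → ℝ} {N : ℕ}

theorem lacunarySum_zero (p : ℕ → ℝ → ℝ) (x : ℝ) : lacunarySum p 0 x = 0 := by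
  simp [lacunarySum]

theorem lacunarySum_succ (p : ℕ → ℝ → ℝ) (N : ℕ) (x : ℝ) :
    lacunarySum p (N + 1) x =
      lacunarySum p N x + p (N + 1) x * Real.cos ((2 : ℝ) ^ (N + 1) * x) :=
  Finset.sum_Icc_succ_top (by omega) _

theorem abs_lacunarySum_succ_sub_le (p : ℕ → ℝ → ℝ) (N : ℕ) (x : ℝ) :
    |lacunarySum p (N + 1) x - lacunarySum p N x| ≤ |p (N + 1) x| := by
  rw [lacunarySum_succ, add_sub_cancel_left, abs_mul]
  exact mul_le_of_le_one_right (abs_nonneg _) (Real.abs_cos_le_one _)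

theorem isRealTrigPolyOfDegreeLE_lacunarySum
    (hp : ∀ j ≤ N, IsRealTrigPolyOfDegreeLE (2 ^ j / 4) (p j)) :
    IsRealTrigPolyOfDegreeLE (2 ^ N / 4 + 2 ^ N) (lacunarySum p N) := by
  refine .sum fun j hj => ?_
  have hjN : j ≤ N := (Finset.mem_Icc.1 hj).2
  have hpow : 2 ^ j ≤ 2 ^ N := Nat.pow_le_pow_right two_pos hjN
  simpa using ((hp j hjN).mul (.cos_natCast_mul (le_refl (2 ^ j)))).mono
    (add_le_add (Nat.div_le_div_right hpow) hpow)

theorem integral_lacunarySum_mul_cos_eq_zero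
    (hp : ∀ j ≤ N + 1, IsRealTrigPolyOfDegreeLE (2 ^ j / 4) (p j)) :
    ∫ x, lacunarySum p N x * p (N + 1) x * Real.cos ((2 : ℝ) ^ (N + 1) * x)
      ∂normalizedMeasure = 0 := by
  have hS := isRealTrigPolyOfDegreeLE_lacunarySum fun j hj => hp j (hj.trans N.le_succ)
  have hdeg : 2 ^ N / 4 + 2 ^ N + 2 ^ (N + 1) / 4 < 2 ^ (N + 1) := by
    have : 0 < 2 ^ N := by positivity
    rw [pow_succ]
    omega
  simpa using (hS.mul (hp (N + 1) le_rfl)).integral_mul_cos_eq_zero hdeg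

theorem integral_lacunarySum_sq_le (hp : ∀ j ≤ N, IsRealTrigPolyOfDegreeLE (2 ^ j / 4) (p j))
    (hp_le : ∀ j ≤ N, ∀ x, |p j x| ≤ 1) :
    ∫ x, lacunarySum p N x ^ 2 ∂normalizedMeasure ≤ N := by
  induction N with
  | zero => simp [lacunarySum_zero]
  | succ N ih =>
    have hS : Continuous (lacunarySum p N) :=
      (isRealTrigPolyOfDegreeLE_lacunarySum fun j hj => hp j (hj.trans N.le_succ)).continuous
    have hS' := (isRealTrigPolyOfDegreeLE_lacunarySum hp).continuous
    have hpc := (hp (N + 1) le_rfl).continuous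
    have hint {f : ℝ → ℝ} (hf : Continuous f) := integrable_normalizedMeasure_of_continuous hf
    have h_expand (x : ℝ) : lacunarySum p (N + 1) x ^ 2 ≤ lacunarySum p N x ^ 2 +
        2 * (lacunarySum p N x * p (N + 1) x * Real.cos ((2 : ℝ) ^ (N + 1) * x)) + 1 := by
      have h_step := (abs_lacunarySum_succ_sub_le p N x).trans (hp_le (N + 1) le_rfl x)
      rw [← sq_le_one_iff_abs_le_one] at h_step
      rw [lacunarySum_succ] at h_step ⊢
      linarith
    calc ∫ x, lacunarySum p (N + 1) x ^ 2 ∂normalizedMeasure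
        ≤ ∫ x, (lacunarySum p N x ^ 2 + 2 * (lacunarySum p N x * p (N + 1) x *
            Real.cos ((2 : ℝ) ^ (N + 1) * x)) + 1) ∂normalizedMeasure :=
          integral_mono (hint (by fun_prop)) (hint (by fun_prop)) h_expand
      _ = ∫ x, lacunarySum p N x ^ 2 ∂normalizedMeasure + 1 := by
          rw [integral_add (hint (by fun_prop)) (hint (by fun_prop)),
            integral_add (hint (by fun_prop)) (hint (by fun_prop)), integral_const_mul,
            integral_lacunarySum_mul_cos_eq_zero hp]
          simp
      _ ≤ (N + 1 : ℕ) := by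
          push_cast
          gcongr
          exact ih (fun j hj => hp j (by omega)) fun j hj => hp_le j (by omega)

end LacunarySum

section PolyCutoff

/-- A polynomial approximation on `[0, 1]` of the indicator function of `[1 / 2, 1]`, used to switch
the coefficients of the lacunary series on and off. -/
def polyCutoff (n : ℕ) (u : ℝ) : ℝ := 1 - (1 - u ^ n) ^ 2 ^ n

variable {n : ℕ} {u : ℝ}

theorem polyCutoff_one (n : ℕ) : polyCutoff n 1 = 1 := by
  simp [polyCutoff]

theorem polyCutoff_mem_Icc (hu : u ∈ Set.Icc 0 1) : polyCutoff n u ∈ Set.Icc 0 1 := by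
  have h_pow : 1 - u ^ n ∈ Set.Icc 0 1 :=
    Set.Icc.one_sub_mem ⟨pow_nonneg hu.1 n, pow_le_one₀ hu.1 hu.2⟩
  exact Set.Icc.one_sub_mem ⟨pow_nonneg h_pow.1 _, pow_le_one₀ h_pow.1 h_pow.2⟩

theorem polyCutoff_le_two_mul_pow (hu : u ∈ Set.Icc 0 1) : polyCutoff n u ≤ (2 * u) ^ n := by
  have h_pow : u ^ n ≤ 1 := pow_le_one₀ hu.1 hu.2
  have h_bernoulli := one_add_mul_le_pow (a := -u ^ n) (by linarith) (2 ^ n)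
  rw [← sub_eq_add_neg] at h_bernoulli
  push_cast at h_bernoulli
  rw [polyCutoff, mul_pow]
  linarith

theorem half_le_polyCutoff (hu : u ∈ Set.Icc (1 / 2) 1) : 1 / 2 ≤ polyCutoff n u := by
  have h_pow : u ^ n ≤ 1 := pow_le_one₀ (by linarith [hu.1]) hu.2
  have h_one_le : 1 ≤ (2 * u) ^ n := one_le_pow₀ (by linarith [hu.1])
  have h_exp : (1 - u ^ n) ^ 2 ^ n ≤ 1 / 2 :=
    calc (1 - u ^ n) ^ 2 ^ n ≤ Real.exp (-u ^ n) ^ 2 ^ n :=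
          pow_le_pow_left₀ (sub_nonneg.2 h_pow) (Real.one_sub_le_exp_neg _) _
      _ = Real.exp (-(2 * u) ^ n) := by
          rw [← Real.exp_nat_mul, mul_pow]
          push_cast
          ring_nf
      _ ≤ Real.exp (-1) := Real.exp_le_exp.2 (neg_le_neg h_one_le)
      _ ≤ 1 / 2 := Real.exp_neg_one_lt_half.le
  rw [polyCutoff]
  linarith

theorem half_sub_le_polyCutoff_one_sub {v : ℝ} (hv : v ∈ Set.Icc 0 1) :
    1 / 2 - v ≤ polyCutoff n (1 - v) := by
  rcases le_total v (1 / 2) with h | h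
  · linarith [half_le_polyCutoff (n := n) (u := 1 - v) ⟨by linarith, by linarith [hv.1]⟩, hv.1]
  · linarith [(polyCutoff_mem_Icc (n := n) (Set.Icc.one_sub_mem hv)).1]

theorem IsRealTrigPolyOfDegreeLE.polyCutoff {d : ℕ} {f : ℝ → ℝ}
    (hf : IsRealTrigPolyOfDegreeLE d f) (n : ℕ) :
    IsRealTrigPolyOfDegreeLE (2 ^ n * (n * d)) fun x => polyCutoff n (f x) :=
  (((hf.pow n).const_sub 1).pow (2 ^ n)).const_sub 1

end PolyCutoff

section DelayedFeedback

theorem one_div_sqrt_succ_le (n : ℕ) :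
    1 / √((n + 1 : ℕ) : ℝ) ≤ 2 * √((n + 1 : ℕ) : ℝ) - 2 * √(n : ℝ) := by
  have h_pos : 0 < √((n + 1 : ℕ) : ℝ) := Real.sqrt_pos.2 (by positivity)
  have h_sq : √((n + 1 : ℕ) : ℝ) ^ 2 = √(n : ℝ) ^ 2 + 1 := by
    rw [Real.sq_sqrt (by positivity), Real.sq_sqrt (by positivity), Nat.cast_succ]
  rw [div_le_iff₀ h_pos]
  nlinarith [sq_nonneg (√((n + 1 : ℕ) : ℝ) - √(n : ℝ))]

/-- If the observed value is below `a * T`, the bounded increments since the observation add at most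
`d * T`; otherwise the current increment is small, and the small increments add up to at most
`2 * √N`. -/
theorem abs_le_of_delayed_feedback {s T : ℕ → ℝ} {m : ℕ → ℕ} {a d K : ℝ} (ha : 0 ≤ a) (hd : 0 ≤ d)
    (hK : a + d + 2 ≤ K) (hT : Monotone T) (hsqrt : ∀ j : ℕ, √(j : ℝ) ≤ T j) (hs : s 0 = 0)
    (hm : ∀ j, m (j + 1) ≤ j)
    (hdelay : ∀ j, ((j + 1 : ℕ) : ℝ) - m (j + 1) ≤ d * T (j + 1))
    (hstep : ∀ j, |s (m (j + 1))| ≤ K * T (j + 1) → |s (j + 1) - s j| ≤ 1)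
    (hfeedback : ∀ j, |s (m (j + 1))| ≤ K * T (j + 1) → a * T (j + 1) ≤ |s (m (j + 1))| →
      |s (j + 1) - s j| ≤ 1 / √((j + 1 : ℕ) : ℝ)) (N : ℕ) :
    |s N| ≤ K * T N := by
  have hT0 (j : ℕ) : 0 ≤ T j := (Real.sqrt_nonneg _).trans (hsqrt j)
  have h_weaken {j : ℕ} (h : |s j| ≤ (a + d) * T j + 2 * √(j : ℝ)) : |s j| ≤ K * T j := by
    nlinarith [hsqrt j, mul_le_mul_of_nonneg_right hK (hT0 j)]
  refine h_weaken ?_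
  induction N using Nat.strong_induction_on with
  | _ N ih =>
    rcases N with _ | N
    · simpa [hs] using mul_nonneg (add_nonneg ha hd) (hT0 0)
    have h_observed (j : ℕ) (hj : j ≤ N) : |s (m (j + 1))| ≤ K * T (j + 1) := by
      have hmj := hm j
      refine (h_weaken (ih _ (by omega))).trans ?_
      exact mul_le_mul_of_nonneg_left (hT (by omega)) (by linarith)
    rcases le_total |s (m (N + 1))| (a * T (N + 1)) with h_small | h_large
    · have h_drift : |s (m (N + 1)) - s (N + 1)| ≤ ((N + 1 : ℕ) : ℝ) - m (N + 1) := by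
        have hmN := (hm N).trans N.le_succ
        have := dist_le_Ico_sum_of_dist_le (f := s) (d := fun _ => 1) hmN fun {j} _ hj => by
          rw [dist_comm, Real.dist_eq]
          exact hstep j (h_observed j (by omega))
        simpa [Real.dist_eq, Nat.cast_sub hmN] using this
      linarith [hdelay N, abs_sub_abs_le_abs_sub (s (N + 1)) (s (m (N + 1))),
        abs_sub_comm (s (N + 1)) (s (m (N + 1))), Real.sqrt_nonneg ((N + 1 : ℕ) : ℝ)]
    · have h_mono := mul_le_mul_of_nonneg_left (hT N.le_succ) (add_nonneg ha hd)
      linarith [ih N N.lt_succ_self, hfeedback N (h_observed N le_rfl) h_large,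
        one_div_sqrt_succ_le N, abs_sub_abs_le_abs_sub (s (N + 1)) (s N)]

end DelayedFeedback

theorem div_sq_mem_Icc {s t : ℝ} (h : |s| ≤ t) : (s / t) ^ 2 ∈ Set.Icc 0 1 := by
  have ht : 0 ≤ t := (abs_nonneg s).trans h
  refine ⟨sq_nonneg _, (sq_le_one_iff_abs_le_one _).2 ?_⟩
  rw [abs_div, abs_of_nonneg ht]
  exact div_le_one_of_le₀ h ht

theorem half_pow_ceil_le_one_div {t : ℝ} (ht : 0 < t) : (1 / 2 : ℝ) ^ ⌈t⌉₊ ≤ 1 / t := by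
  rw [one_div_pow]
  refine one_div_le_one_div_of_le ht ((Nat.le_ceil t).trans ?_)
  exact_mod_cast (Nat.lt_two_pow_self (n := ⌈t⌉₊)).le

section ControlledCoeff

/-- The index of the partial sum on which the coefficient of index `j` depends. The delay
`3 * ⌈T j⌉₊ + 4` makes room for the factor `2 ^ (2 * ⌈T j⌉₊ + 2)` by which the cutoff raises the
degree and for the target degree `2 ^ (j - T j)`. When `j` is smaller than the delay, truncated
subtraction makes the index `0`, and hence the coefficient constant. -/
noncomputable def observedIndex (T : ℕ → ℝ) (j : ℕ) : ℕ := j - (3 * ⌈T j⌉₊ + 4)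

theorem observedIndex_le (T : ℕ → ℝ) (j : ℕ) : observedIndex T j ≤ j := Nat.sub_le _ _

theorem lt_of_mem_Icc_observedIndex {T : ℕ → ℝ} {i j : ℕ}
    (hi : i ∈ Finset.Icc 1 (observedIndex T j)) : i < j := by
  rw [Finset.mem_Icc, observedIndex] at hi
  omega

/-- The coefficient of `cos (2 ^ j * x)` in the controlled lacunary sum: it is switched off where
the partial sum of index `observedIndex T j` is close to `± 100 * T j`. The constant is
`100 = 88 + 10 + 2`: beyond `88 * T j` the coefficient is tiny, the delay adds at most `10 * T j`,
and all the tiny terms together add at most `2 * T j`. -/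
noncomputable def controlledCoeff (T : ℕ → ℝ) (j : ℕ) (x : ℝ) : ℝ :=
  polyCutoff ⌈T j⌉₊ (1 - ((∑ i ∈ (Finset.Icc 1 (observedIndex T j)).attach,
    controlledCoeff T i x * Real.cos ((2 : ℝ) ^ (i : ℕ) * x)) / (100 * T j)) ^ 2)
termination_by j
decreasing_by exact lt_of_mem_Icc_observedIndex i.2

/-- The lacunary sum with coefficients `controlledCoeff T`. -/
noncomputable abbrev controlledSum (T : ℕ → ℝ) : ℕ → ℝ → ℝ := lacunarySum (controlledCoeff T)

variable {T : ℕ → ℝ} {j : ℕ} {x : ℝ}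

theorem controlledCoeff_eq (T : ℕ → ℝ) (j : ℕ) (x : ℝ) :
    controlledCoeff T j x =
      polyCutoff ⌈T j⌉₊ (1 - (controlledSum T (observedIndex T j) x / (100 * T j)) ^ 2) := by
  rw [controlledCoeff, controlledSum, lacunarySum, Finset.sum_attach _
    fun i => controlledCoeff T i x * Real.cos ((2 : ℝ) ^ i * x)]

theorem controlledCoeff_of_observedIndex_eq_zero (h : observedIndex T j = 0) (x : ℝ) :
    controlledCoeff T j x = 1 := by
  simp [controlledCoeff_eq, h, lacunarySum_zero, polyCutoff_one]

/-- An upper bound for the degree of `controlledCoeff T j`. -/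
noncomputable def coeffDegree (T : ℕ → ℝ) (j : ℕ) : ℕ :=
  if observedIndex T j = 0 then 0 else 2 ^ (observedIndex T j + 2 * ⌈T j⌉₊ + 2)

theorem coeffDegree_le_two_pow_div_four (T : ℕ → ℝ) (j : ℕ) : coeffDegree T j ≤ 2 ^ j / 4 := by
  rw [coeffDegree, Nat.le_div_iff_mul_le four_pos]
  split_ifs with h
  · simp
  · calc 2 ^ (observedIndex T j + 2 * ⌈T j⌉₊ + 2) * 4
        = 2 ^ (observedIndex T j + 2 * ⌈T j⌉₊ + 4) := by ring
      _ ≤ 2 ^ j := Nat.pow_le_pow_right two_pos (by unfold observedIndex at *; omega)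

theorem coeffDegree_le_two_rpow (T : ℕ → ℝ) (j : ℕ) :
    (coeffDegree T j : ℝ) ≤ (2 : ℝ) ^ ((j : ℝ) - T j) := by
  rw [coeffDegree]
  split_ifs with h
  · simpa using (Real.rpow_pos_of_pos two_pos _).le
  · have h_nat : observedIndex T j + 2 * ⌈T j⌉₊ + 2 + ⌈T j⌉₊ ≤ j := by
      unfold observedIndex at *
      omega
    have h_real : ((observedIndex T j + 2 * ⌈T j⌉₊ + 2 : ℕ) : ℝ) + ⌈T j⌉₊ ≤ j := mod_cast h_nat
    rw [Nat.cast_pow, Nat.cast_ofNat, ← Real.rpow_natCast]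
    exact Real.rpow_le_rpow_of_exponent_le one_le_two (by linarith [Nat.le_ceil (T j)])

theorem isRealTrigPolyOfDegreeLE_controlledCoeff (T : ℕ → ℝ) (j : ℕ) :
    IsRealTrigPolyOfDegreeLE (coeffDegree T j) (controlledCoeff T j) := by
  induction j using Nat.strong_induction_on with
  | _ j ih =>
    rw [coeffDegree]
    split_ifs with h
    · rw [funext (controlledCoeff_of_observedIndex_eq_zero h)]
      exact .const 0 1
    have h_lt : observedIndex T j < j :=
      lt_of_mem_Icc_observedIndex (Finset.right_mem_Icc.2 (Nat.one_le_iff_ne_zero.2 h))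
    have hS : IsRealTrigPolyOfDegreeLE _ (controlledSum T (observedIndex T j)) :=
      isRealTrigPolyOfDegreeLE_lacunarySum fun i hi =>
        (ih i (hi.trans_lt h_lt)).mono (coeffDegree_le_two_pow_div_four T i)
    rw [funext (controlledCoeff_eq T j)]
    simp only [div_eq_inv_mul]
    refine ((((hS.const_mul (100 * T j)⁻¹).pow 2).const_sub 1).polyCutoff ⌈T j⌉₊).mono ?_
    generalize observedIndex T j = m
    generalize ⌈T j⌉₊ = n
    calc 2 ^ n * (n * (2 * (2 ^ m / 4 + 2 ^ m))) ≤ 2 ^ n * (2 ^ n * (2 * (2 ^ m + 2 ^ m))) := by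
          gcongr
          · exact Nat.lt_two_pow_self.le
          · exact Nat.div_le_self _ _
      _ = 2 ^ (m + 2 * n + 2) := by ring

theorem isRealTrigPolyOfDegreeLE_controlledCoeff_two_pow_div_four (T : ℕ → ℝ) (j : ℕ) :
    IsRealTrigPolyOfDegreeLE (2 ^ j / 4) (controlledCoeff T j) :=
  (isRealTrigPolyOfDegreeLE_controlledCoeff T j).mono (coeffDegree_le_two_pow_div_four T j)

theorem continuous_controlledSum (T : ℕ → ℝ) (N : ℕ) : Continuous (controlledSum T N) :=
  (isRealTrigPolyOfDegreeLE_lacunarySum fun j _ =>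
    isRealTrigPolyOfDegreeLE_controlledCoeff_two_pow_div_four T j).continuous

theorem controlledCoeff_mem_Icc (h : |controlledSum T (observedIndex T j) x| ≤ 100 * T j) :
    controlledCoeff T j x ∈ Set.Icc 0 1 := by
  rw [controlledCoeff_eq]
  exact polyCutoff_mem_Icc (Set.Icc.one_sub_mem (div_sq_mem_Icc h))

theorem half_sub_le_controlledCoeff (h : |controlledSum T (observedIndex T j) x| ≤ 100 * T j) :
    1 / 2 - controlledSum T (observedIndex T j) x ^ 2 / (100 * T j) ^ 2 ≤
      controlledCoeff T j x := by
  rw [controlledCoeff_eq, ← div_pow]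
  exact half_sub_le_polyCutoff_one_sub (div_sq_mem_Icc h)

theorem controlledCoeff_le_half_pow (hT : 0 < T j)
    (h : |controlledSum T (observedIndex T j) x| ≤ 100 * T j)
    (h_large : 88 * T j ≤ |controlledSum T (observedIndex T j) x|) :
    controlledCoeff T j x ≤ (1 / 2) ^ ⌈T j⌉₊ := by
  have hv := div_sq_mem_Icc h
  have h_abs : 88 / 100 ≤ |controlledSum T (observedIndex T j) x / (100 * T j)| := by
    rw [abs_div, abs_of_pos (by positivity : 0 < 100 * T j), le_div_iff₀ (by positivity)]
    linarith
  have h_sq : 3 / 4 ≤ (controlledSum T (observedIndex T j) x / (100 * T j)) ^ 2 := by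
    rw [← sq_abs]
    nlinarith
  rw [controlledCoeff_eq]
  refine (polyCutoff_le_two_mul_pow (Set.Icc.one_sub_mem hv)).trans ?_
  exact pow_le_pow_left₀ (by linarith [hv.2]) (by linarith) _

theorem sub_observedIndex_le (hT : 1 ≤ T j) : (j : ℝ) - observedIndex T j ≤ 10 * T j := by
  have h_nat : j ≤ observedIndex T j + (3 * ⌈T j⌉₊ + 4) := le_tsub_add
  have h_real : (j : ℝ) ≤ observedIndex T j + (3 * ⌈T j⌉₊ + 4) := mod_cast h_nat
  linarith [Nat.ceil_lt_add_one (zero_le_one.trans hT)]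

theorem abs_controlledSum_le (hT : Monotone T) (hsqrt : ∀ j : ℕ, √(j : ℝ) ≤ T j) (N : ℕ) (x : ℝ) :
    |controlledSum T N x| ≤ 100 * T N := by
  have hT1 (j : ℕ) : 1 ≤ T (j + 1) :=
    (Real.one_le_sqrt.2 (by exact_mod_cast j.succ_pos)).trans (hsqrt (j + 1))
  refine abs_le_of_delayed_feedback (s := fun N => controlledSum T N x) (m := observedIndex T)
    (a := 88) (d := 10) (by norm_num) (by norm_num) (by norm_num) hT hsqrt (lacunarySum_zero _ x)
    (fun j => by unfold observedIndex; omega) (fun j => sub_observedIndex_le (hT1 j))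
    (fun j h => ?_) (fun j h h_large => ?_) N
  all_goals
    have hmem := controlledCoeff_mem_Icc h
    refine (abs_lacunarySum_succ_sub_le _ j x).trans ?_
    rw [abs_of_nonneg hmem.1]
  · exact hmem.2
  · have h_pos : 0 < T (j + 1) := zero_lt_one.trans_le (hT1 j)
    exact (controlledCoeff_le_half_pow h_pos h h_large).trans
      ((half_pow_ceil_le_one_div h_pos).trans
        (one_div_le_one_div_of_le (Real.sqrt_pos.2 (by positivity)) (hsqrt (j + 1))))

theorem abs_controlledSum_observedIndex_le (hT : Monotone T) (hsqrt : ∀ j : ℕ, √(j : ℝ) ≤ T j)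
    (j : ℕ) (x : ℝ) : |controlledSum T (observedIndex T j) x| ≤ 100 * T j :=
  (abs_controlledSum_le hT hsqrt _ x).trans (by gcongr; exact hT (observedIndex_le T j))

theorem abs_controlledCoeff_le_one (hT : Monotone T) (hsqrt : ∀ j : ℕ, √(j : ℝ) ≤ T j)
    (j : ℕ) (x : ℝ) : |controlledCoeff T j x| ≤ 1 := by
  have hmem := controlledCoeff_mem_Icc (abs_controlledSum_observedIndex_le hT hsqrt j x)
  rw [abs_of_nonneg hmem.1]
  exact hmem.2

theorem integral_controlledSum_observedIndex_sq_le (hT : Monotone T)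
    (hsqrt : ∀ j : ℕ, √(j : ℝ) ≤ T j) (j : ℕ) :
    ∫ x, controlledSum T (observedIndex T j) x ^ 2 ∂normalizedMeasure ≤ T j ^ 2 :=
  calc ∫ x, controlledSum T (observedIndex T j) x ^ 2 ∂normalizedMeasure
      ≤ observedIndex T j := integral_lacunarySum_sq_le
        (fun i _ => isRealTrigPolyOfDegreeLE_controlledCoeff_two_pow_div_four T i)
        fun i _ => abs_controlledCoeff_le_one hT hsqrt i
    _ ≤ j := mod_cast observedIndex_le T j
    _ ≤ T j ^ 2 := (Real.sqrt_le_left ((Real.sqrt_nonneg _).trans (hsqrt j))).1 (hsqrt j)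

theorem quarter_le_integral_controlledCoeff (hT : Monotone T)
    (hsqrt : ∀ j : ℕ, √(j : ℝ) ≤ T j) (j : ℕ) :
    1 / 4 ≤ ∫ x, controlledCoeff T j x ∂normalizedMeasure := by
  have hS := continuous_controlledSum T (observedIndex T j)
  have hp := (isRealTrigPolyOfDegreeLE_controlledCoeff T j).continuous
  have hint {f : ℝ → ℝ} (hf : Continuous f) := integrable_normalizedMeasure_of_continuous hf
  have h_ratio : (∫ x, controlledSum T (observedIndex T j) x ^ 2 ∂normalizedMeasure) /
      (100 * T j) ^ 2 ≤ 1 / 4 := by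
    refine div_le_of_le_mul₀ (sq_nonneg _) (by norm_num) ?_
    linarith [integral_controlledSum_observedIndex_sq_le hT hsqrt j, sq_nonneg (T j)]
  calc (1 / 4 : ℝ)
      ≤ 1 / 2 - (∫ x, controlledSum T (observedIndex T j) x ^ 2 ∂normalizedMeasure) /
          (100 * T j) ^ 2 := by linarith
    _ = ∫ x, (1 / 2 - controlledSum T (observedIndex T j) x ^ 2 / (100 * T j) ^ 2)
          ∂normalizedMeasure := by
        rw [integral_sub (hint (by fun_prop)) (hint (by fun_prop)), integral_const, integral_div]
        simp
    _ ≤ ∫ x, controlledCoeff T j x ∂normalizedMeasure :=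
        integral_mono (hint (by fun_prop)) (hint hp) fun x =>
          half_sub_le_controlledCoeff (abs_controlledSum_observedIndex_le hT hsqrt j x)

end ControlledCoeff

theorem monotone_natCast_rpow {α : ℝ} (hα : 0 ≤ α) : Monotone fun j : ℕ => (j : ℝ) ^ α :=
  fun _ _ hij => Real.rpow_le_rpow (by positivity) (by exact_mod_cast hij) hα

theorem natCast_rpow_le_rpow {α β : ℝ} (h : α ≤ β) {j : ℕ} (hj : 1 ≤ j) :
    (j : ℝ) ^ α ≤ (j : ℝ) ^ β :=
  Real.rpow_le_rpow_of_exponent_le (by exact_mod_cast hj) h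

theorem sqrt_natCast_le_rpow {α : ℝ} (hα : 1 / 2 ≤ α) (j : ℕ) : √(j : ℝ) ≤ (j : ℝ) ^ α := by
  rcases j.eq_zero_or_pos with rfl | hj
  · simpa using Real.rpow_nonneg le_rfl α
  · rw [Real.sqrt_eq_rpow]
    exact natCast_rpow_le_rpow hα hj

theorem mainTheorem2_general {T : ℕ → ℝ} (hT : Monotone T) (hsqrt : ∀ j : ℕ, √(j : ℝ) ≤ T j) :
    ∃ p : ℕ → ℝ → ℝ,
      (∀ j : ℕ,
        IsRealTrigPoly (p j) ∧
        (trigDegree (p j) : ℝ) ≤ (2 : ℝ) ^ ((j : ℝ) - T j) ∧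
        ENNReal.ofReal (1 / 4) ≤ trigNorm 1 (p j) ∧
        trigNorm 1 (p j) ≤ trigNorm ⊤ (p j) ∧
        trigNorm ⊤ (p j) ≤ ENNReal.ofReal 1) ∧
      ∀ N : ℕ,
        trigNorm ⊤ (fun x : ℝ => ∑ j ∈ Finset.Icc 1 N, p j x * Real.cos ((2 : ℝ) ^ j * x)) ≤
          ENNReal.ofReal (100 * T N) := by
  refine ⟨controlledCoeff T, fun j => ?_, fun N =>
    trigNorm_top_le (abs_controlledSum_le hT hsqrt N)⟩
  have hp := isRealTrigPolyOfDegreeLE_controlledCoeff T j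
  refine ⟨⟨_, hp⟩, (Nat.cast_le.2 hp.trigDegree_le).trans (coeffDegree_le_two_rpow T j), ?_,
    trigNorm_one_le_trigNorm_top hp.continuous,
    trigNorm_top_le (abs_controlledCoeff_le_one hT hsqrt j)⟩
  exact (ENNReal.ofReal_le_ofReal (quarter_le_integral_controlledCoeff hT hsqrt j)).trans
    (ofReal_integral_le_trigNorm_one _)

theorem mainTheorem2 :
    ∃ cMinus cPlus C : ℝ, 0 < cMinus ∧ 0 < cPlus ∧ 0 < C ∧
      ∀ ε : ℝ, 0 ≤ ε → ε < 1 →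
        ∃ p : ℕ → ℝ → ℝ,
          (∀ j : ℕ, 1 ≤ j →
            IsRealTrigPoly (p j) ∧
            (trigDegree (p j) : ℝ) ≤ (2 : ℝ) ^ ((j : ℝ) - (j : ℝ) ^ ε) ∧
            ENNReal.ofReal cMinus ≤ trigNorm 1 (p j) ∧
            trigNorm 1 (p j) ≤ trigNorm ⊤ (p j) ∧
            trigNorm ⊤ (p j) ≤ ENNReal.ofReal cPlus) ∧
          ∀ N : ℕ, 1 ≤ N →
            trigNorm ⊤ (fun x : ℝ =>
                ∑ j ∈ Finset.Icc 1 N, p j x * Real.cos ((2 : ℝ) ^ j * x))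
              ≤ ENNReal.ofReal (C * (N : ℝ) ^ (max ε (1 / 2))) := by
  refine ⟨1 / 4, 1, 100, by norm_num, one_pos, by norm_num, fun ε _ _ => ?_⟩
  have hα : 1 / 2 ≤ max ε (1 / 2) := le_max_right _ _
  obtain ⟨p, hp, hS⟩ := mainTheorem2_general
    (monotone_natCast_rpow (one_half_pos.le.trans hα)) (sqrt_natCast_le_rpow hα)
  refine ⟨p, fun j hj => ?_, fun N _ => hS N⟩
  obtain ⟨hpoly, hdeg, hnorm⟩ := hp j
  refine ⟨hpoly, hdeg.trans ?_, hnorm⟩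
  exact Real.rpow_le_rpow_of_exponent_le one_le_two
    (sub_le_sub_left (natCast_rpow_le_rpow (le_max_left _ _) hj) _)
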